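/- Let $X$ be a real or complex Banach space and let $V\in\mathcal L(X)$ be a bounded linear operator on $X$. Write $\rho(V)$ for the resolvent set of $V$ and $R(\mu,V)=(\mu I-V)^{-1}$ for $\mu\in\rho(V)$. If $A$ is the generator of a $C_0$-semigroup on $X$ with $1\in\rho(A)$, the cogenerator of the semigroup is the bounded operator $(A+I)(A-I)^{-1}$. The following conditions are equivalent. (i) $V$ is the cogenerator of a contraction $C_0$-semigroup $(T(t))_{t\ge 0}$ on $X$ (that is, $\|T(t)\|\le 1$ for all $t\ge 0$). (ii) $V-I$ is injective and has dense range, $(1,\infty)\subset\rho(V)$, and $$\|(I-V)R(\mu,V)\|\le\frac{2}{\mu+1}\quad\text{for all }\mu>1.$$ (iii) $V-I$ is injective and has dense range, and there exists $\mu_0>1$ such that $(1,\mu_0)\subset\rho(V)$ and $$\|(I-V)R(\mu,V)\|\le\frac{2}{\mu+1}\quad\text{for all }\mu\in(1,\mu_0).$$ -/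

import Mathlib

open Filter Topology
open scoped NNReal

/-- A `C₀`-semigroup of bounded operators on `X`: a family `T(t)`, `t ≥ 0`, with `T(0) = I`,
`T(s + t) = T(s) T(t)` and all orbits `t ↦ T(t) x` continuous on `[0, ∞)`. -/
structure C0Semigroup (𝕜 X : Type*) [RCLike 𝕜] [NormedAddCommGroup X] [NormedSpace 𝕜 X] where
  /-- The operator `T(t)`. -/
  op : ℝ≥0 → X →L[𝕜] X
  op_zero : op 0 = ContinuousLinearMap.id 𝕜 X
  op_add : ∀ s t : ℝ≥0, op (s + t) = (op s).comp (op t)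
  continuous_orbit : ∀ x : X, Continuous fun t : ℝ≥0 => op t x

namespace C0Semigroup

variable {𝕜 X : Type*} [RCLike 𝕜] [NormedAddCommGroup X] [NormedSpace 𝕜 X]

/-- All operators `T(t)` are contractions. -/
def IsContraction (T : C0Semigroup 𝕜 X) : Prop :=
  ∀ t : ℝ≥0, ‖T.op t‖ ≤ 1

/-- The difference quotient `h⁻¹ (T(h) x - x)`. -/
noncomputable def diffQuot (T : C0Semigroup 𝕜 X) (x : X) (h : ℝ≥0) : X :=
  (((h : ℝ) : 𝕜)⁻¹) • (T.op h x - x)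

theorem tendsto_diffQuot_add (T : C0Semigroup 𝕜 X) {x x' y y' : X}
    (h : Tendsto (T.diffQuot x) (𝓝[>] 0) (𝓝 y)) (h' : Tendsto (T.diffQuot x') (𝓝[>] 0) (𝓝 y')) :
    Tendsto (T.diffQuot (x + x')) (𝓝[>] 0) (𝓝 (y + y')) := by
  refine (h.add h').congr fun s => ?_
  simp only [diffQuot, map_add, ← smul_add]
  congr 1
  abel

theorem tendsto_diffQuot_smul (T : C0Semigroup 𝕜 X) (c : 𝕜) {x y : X}
    (h : Tendsto (T.diffQuot x) (𝓝[>] 0) (𝓝 y)) :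
    Tendsto (T.diffQuot (c • x)) (𝓝[>] 0) (𝓝 (c • y)) := by
  refine (h.const_smul c).congr fun s => ?_
  simp only [diffQuot, map_smul, ← smul_sub, smul_comm c]

/-- The domain of the generator: all `x` for which `lim_{h → 0+} h⁻¹ (T(h) x - x)` exists. -/
def generatorDomain (T : C0Semigroup 𝕜 X) : Submodule 𝕜 X where
  carrier := {x | ∃ y, Tendsto (T.diffQuot x) (𝓝[>] 0) (𝓝 y)}
  zero_mem' := ⟨0, tendsto_const_nhds.congr fun s => by simp [diffQuot]⟩
  add_mem' := fun ⟨y, h⟩ ⟨y', h'⟩ => ⟨y + y', T.tendsto_diffQuot_add h h'⟩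
  smul_mem' := fun c _ ⟨y, h⟩ => ⟨c • y, T.tendsto_diffQuot_smul c h⟩

/-- The generator `A x = lim_{h → 0+} h⁻¹ (T(h) x - x)`, a partially defined operator. -/
noncomputable def generator (T : C0Semigroup 𝕜 X) : X →ₗ.[𝕜] X where
  domain := T.generatorDomain
  toFun :=
    { toFun := fun x => x.2.choose
      map_add' := fun x x' => tendsto_nhds_unique (x + x').2.choose_spec
        (T.tendsto_diffQuot_add x.2.choose_spec x'.2.choose_spec)
      map_smul' := fun c x => tendsto_nhds_unique (c • x).2.choose_spec
        (T.tendsto_diffQuot_smul c x.2.choose_spec) }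

end C0Semigroup

/-- The bounded everywhere defined operator `R` is the inverse `(A - λ I)⁻¹` of the operator
`A - λ I : D(A) → X`. Such an `R` exists precisely if `λ` is in the resolvent set of `A`. -/
def IsShiftInverse {𝕜 X : Type*} [RCLike 𝕜] [NormedAddCommGroup X] [NormedSpace 𝕜 X]
    (A : X →ₗ.[𝕜] X) (lam : 𝕜) (R : X →L[𝕜] X) : Prop :=
  (∀ y : X, ∃ h : R y ∈ A.domain, A ⟨R y, h⟩ - lam • R y = y) ∧
    ∀ x : A.domain, R (A x - lam • (x : X)) = x

/-- `V` is the cogenerator of `T`: `1` is in the resolvent set of the generator `A` of `T`, and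
`V = (A + I) (A - I)⁻¹`. -/
def IsCogenerator {𝕜 X : Type*} [RCLike 𝕜] [NormedAddCommGroup X] [NormedSpace 𝕜 X]
    (V : X →L[𝕜] X) (T : C0Semigroup 𝕜 X) : Prop :=
  ∃ R : X →L[𝕜] X, IsShiftInverse T.generator 1 R ∧
    ∀ y : X, ∃ h : R y ∈ T.generator.domain, V y = T.generator ⟨R y, h⟩ + R y

/-! The theorem is the Hille–Yosida theorem transported by the Cayley transform. For `A = (V + 1)(V
- 1)⁻¹` and `λ = (μ + 1)/(μ - 1)` one has `λ - A = 2/(μ - 1) • (μ - V)(1 - V)⁻¹`, hence `λ R(λ, A) =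
(μ + 1)/2 • (1 - V) R(μ, V)`. The bound on `V` therefore says `‖λ R(λ, A)‖ ≤ 1`, and `μ → 1+`
corresponds to `λ → ∞`.

Necessity: the generator of a contraction semigroup is dissipative, which is the bound in the form
of a lower estimate for `μ - V` (`IsCogenerator.norm_one_sub_apply_le`). A connectedness argument
puts all of `(1, ∞)` in the resolvent set.

Sufficiency: Yosida approximation needs only a sequence `λ → ∞`, so a bound near `μ = 1` is enough.
Everything is expressed through `V`, with the range of `V - 1` as the dense set on which limits are
computed (`exists_isCogenerator_of_norm_le`). -/

/-! ### Exponentials of bounded operators: contractivity and orbit estimates. -/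

section ExpOrbit

variable {𝕜 X : Type*} [RCLike 𝕜] [NormedAddCommGroup X] [NormedSpace 𝕜 X] [CompleteSpace X]

theorem exp_add_of_commute_clm {A B : X →L[𝕜] X} (h : Commute A B) :
    NormedSpace.exp (A + B) = NormedSpace.exp A * NormedSpace.exp B := by
  let : NormedAlgebra ℚ 𝕜 := NormedAlgebra.restrictScalars ℚ ℝ 𝕜
  let : NormedAlgebra ℚ (X →L[𝕜] X) := NormedAlgebra.restrictScalars ℚ 𝕜 (X →L[𝕜] X)
  exact NormedSpace.exp_add_of_commute h

/-- The operator `exp (c (J - 1))` is a contraction if `J` is one. -/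
theorem norm_exp_smul_sub_one_le {J : X →L[𝕜] X} (hJ : ‖J‖ ≤ 1) {c : ℝ} (hc : 0 ≤ c) :
    ‖NormedSpace.exp ((c : 𝕜) • (J - 1))‖ ≤ 1 := by
  have hpow : ∀ n : ℕ, ‖J ^ n‖ ≤ 1 := by
    intro n
    induction n with
    | zero => exact ContinuousLinearMap.norm_id_le
    | succ n ih =>
      rw [pow_succ]
      exact (norm_mul_le _ _).trans (mul_le_one₀ ih (norm_nonneg _) hJ)
  have h1 : ‖NormedSpace.exp ((c : 𝕜) • J)‖ ≤ Real.exp c := by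
    have hs := NormedSpace.exp_series_hasSum_exp' (𝕂 := 𝕜) ((c : 𝕜) • J)
    have hr := NormedSpace.exp_series_hasSum_exp' (𝕂 := ℝ) c
    rw [← Real.exp_eq_exp_ℝ] at hr
    refine hs.norm_le_of_bounded hr fun n => ?_
    rw [smul_pow, norm_smul, norm_smul, norm_inv, RCLike.norm_natCast, norm_pow,
      RCLike.norm_ofReal, abs_of_nonneg hc, smul_eq_mul]
    exact mul_le_mul_of_nonneg_left
      (mul_le_of_le_one_right (by positivity) (hpow n)) (by positivity)
  have h2 : NormedSpace.exp ((c : 𝕜) • (J - 1)) =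
      ((Real.exp (-c) : ℝ) : 𝕜) • NormedSpace.exp ((c : 𝕜) • J) := by
    have e : (c : 𝕜) • (J - 1) = (c : 𝕜) • J + algebraMap 𝕜 (X →L[𝕜] X) ((-c : ℝ) : 𝕜) := by
      rw [Algebra.algebraMap_eq_smul_one]
      push_cast
      module
    have hr : NormedSpace.exp ((-c : ℝ) : 𝕜) = ((Real.exp (-c) : ℝ) : 𝕜) := by
      rw [Real.exp_eq_exp_ℝ]
      exact (NormedSpace.algebraMap_exp_comm (𝕂 := ℝ) (𝔸 := 𝕜) (-c)).symm
    rw [e, exp_add_of_commute_clm (Algebra.commute_algebraMap_right _ _),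
      ← NormedSpace.algebraMap_exp_comm, hr, ← Algebra.commutes, ← Algebra.smul_def]
  rw [h2, norm_smul, RCLike.norm_ofReal, abs_of_pos (Real.exp_pos _)]
  calc Real.exp (-c) * ‖NormedSpace.exp ((c : 𝕜) • J)‖ ≤ Real.exp (-c) * Real.exp c := by gcongr
    _ = 1 := by rw [← Real.exp_add]; simp

theorem hasDerivAt_exp_smul_apply [NormedSpace ℝ X] [IsScalarTower ℝ 𝕜 X]
    (A : X →L[𝕜] X) (x : X) (t : ℝ) :
    HasDerivAt (fun s : ℝ => NormedSpace.exp ((s : 𝕜) • A) x)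
      (NormedSpace.exp ((t : 𝕜) • A) (A x)) t := by
  have h1 : HasDerivAt (fun u : 𝕜 => NormedSpace.exp (u • A) x)
      (NormedSpace.exp ((t : 𝕜) • A) (A x)) (t : 𝕜) :=
    (ContinuousLinearMap.apply 𝕜 X x).hasFDerivAt.comp_hasDerivAt _
      (hasDerivAt_exp_smul_const A (t : 𝕜))
  have h2 : HasDerivAt (fun s : ℝ => (s : 𝕜)) 1 t := by
    simpa using (RCLike.ofRealCLM (K := 𝕜)).hasDerivAt (x := t)
  have h3 := h1.scomp t h2
  rw [one_smul] at h3
  exact h3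

/-- Two commuting uniformly continuous contraction semigroups differ on `x` by at most `t` times
the difference of their generators. -/
theorem norm_exp_smul_apply_sub_exp_smul_apply_le {A B : X →L[𝕜] X} (h : Commute A B)
    (hA : ∀ s : ℝ, 0 ≤ s → ‖NormedSpace.exp ((s : 𝕜) • A)‖ ≤ 1)
    (hB : ∀ s : ℝ, 0 ≤ s → ‖NormedSpace.exp ((s : 𝕜) • B)‖ ≤ 1) (x : X) {t : ℝ} (ht : 0 ≤ t) :
    ‖NormedSpace.exp ((t : 𝕜) • A) x - NormedSpace.exp ((t : 𝕜) • B) x‖ ≤ ‖A x - B x‖ * t := by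
  let : NormedSpace ℝ X := NormedSpace.restrictScalars ℝ 𝕜 X
  have hAB : Commute (A - B) B := h.sub_left (Commute.refl B)
  -- The path `exp (tB) exp (s(A - B)) x` joins `exp (tB) x` at `s = 0` to `exp (tA) x` at `s = t`.
  -- By this identity its derivative is `(A - B) x` under a product of two contractions.
  have key : ∀ s : ℝ, NormedSpace.exp ((t : 𝕜) • B) * NormedSpace.exp ((s : 𝕜) • (A - B)) =
      NormedSpace.exp ((s : 𝕜) • A) * NormedSpace.exp (((t - s : ℝ) : 𝕜) • B) := by
    intro s
    rw [← exp_add_of_commute_clm ((hAB.symm.smul_left _).smul_right _),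
      ← exp_add_of_commute_clm ((h.smul_left _).smul_right _)]
    congr 1
    push_cast
    module
  have hd : ∀ s : ℝ, HasDerivAt
      (fun s : ℝ => NormedSpace.exp ((t : 𝕜) • B) (NormedSpace.exp ((s : 𝕜) • (A - B)) x))
      (NormedSpace.exp ((t : 𝕜) • B) (NormedSpace.exp ((s : 𝕜) • (A - B)) ((A - B) x))) s := by
    intro s
    exact ((NormedSpace.exp ((t : 𝕜) • B)).restrictScalars ℝ).hasFDerivAt.comp_hasDerivAt _
      (hasDerivAt_exp_smul_apply (A - B) x s)
  have := norm_image_sub_le_of_norm_deriv_le_segment'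
    (fun s (_ : s ∈ Set.Icc 0 t) => (hd s).hasDerivWithinAt) (C := ‖A x - B x‖)
    (fun s hs => ?_) t ⟨ht, le_rfl⟩
  · have k1 := DFunLike.congr_fun (key t) x
    simp only [mul_apply_eq_comp, sub_self, RCLike.ofReal_zero, zero_smul,
      NormedSpace.exp_zero, one_apply_eq_self] at k1
    simp only [RCLike.ofReal_zero, zero_smul, NormedSpace.exp_zero, one_apply_eq_self,
      sub_zero] at this
    rwa [k1] at this
  · have k1 := DFunLike.congr_fun (key s) ((A - B) x)
    simp only [mul_apply_eq_comp] at k1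
    rw [k1]
    refine ((NormedSpace.exp ((s : 𝕜) • A)).le_of_opNorm_le (hA s hs.1) _).trans ?_
    rw [one_mul]
    refine ((NormedSpace.exp (((t - s : ℝ) : 𝕜) • B)).le_of_opNorm_le
      (hB _ (sub_nonneg.2 hs.2.le)) _).trans ?_
    rw [one_mul, sub_apply]

theorem norm_exp_smul_apply_sub_le {A : X →L[𝕜] X}
    (hA : ∀ s : ℝ, 0 ≤ s → ‖NormedSpace.exp ((s : 𝕜) • A)‖ ≤ 1) (x : X) {t : ℝ} (ht : 0 ≤ t) :
    ‖NormedSpace.exp ((t : 𝕜) • A) x - x‖ ≤ ‖A x‖ * t := by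
  simpa using norm_exp_smul_apply_sub_exp_smul_apply_le (Commute.zero_right A) hA
    (fun s _ => by simpa using! ContinuousLinearMap.norm_id_le) x ht

/-- A first order Taylor estimate for the orbit of `x`; the point `z` is meant to approximate
`A x`. -/
theorem norm_exp_smul_apply_sub_sub_le {A : X →L[𝕜] X}
    (hA : ∀ s : ℝ, 0 ≤ s → ‖NormedSpace.exp ((s : 𝕜) • A)‖ ≤ 1) (x z : X) {t : ℝ} (ht : 0 ≤ t) :
    ‖NormedSpace.exp ((t : 𝕜) • A) x - x - (t : 𝕜) • A x‖ ≤
      (2 * ‖A x - z‖ + ‖A z‖ * t) * t := by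
  let : NormedSpace ℝ X := NormedSpace.restrictScalars ℝ 𝕜 X
  have hd : ∀ s : ℝ, HasDerivAt
      (fun s : ℝ => NormedSpace.exp ((s : 𝕜) • A) x - (s : 𝕜) • A x)
      (NormedSpace.exp ((s : 𝕜) • A) (A x) - A x) s := by
    intro s
    refine (hasDerivAt_exp_smul_apply A x s).sub ?_
    have h2 : HasDerivAt (fun s : ℝ => (s : 𝕜)) 1 s := by
      simpa using (RCLike.ofRealCLM (K := 𝕜)).hasDerivAt (x := s)
    simpa using h2.smul_const (A x)
  have := norm_image_sub_le_of_norm_deriv_le_segment'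
    (fun s (_ : s ∈ Set.Icc 0 t) => (hd s).hasDerivWithinAt) (C := 2 * ‖A x - z‖ + ‖A z‖ * t)
    (fun s hs => ?_) t ⟨ht, le_rfl⟩
  · rw [sub_right_comm]
    simpa using this
  -- Splitting off `z` avoids `‖A (A x)‖`, which need not stay bounded along the approximating
  -- sequence, whereas `‖A z‖` does for `z` in the dense set.
  · have e : NormedSpace.exp ((s : 𝕜) • A) (A x) - A x =
        NormedSpace.exp ((s : 𝕜) • A) (A x - z) - (A x - z) +
          (NormedSpace.exp ((s : 𝕜) • A) z - z) := by
      rw [map_sub]; abel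
    rw [e]
    have h1 := (NormedSpace.exp ((s : 𝕜) • A)).le_of_opNorm_le (hA s hs.1) (A x - z)
    have h2 := norm_sub_le (NormedSpace.exp ((s : 𝕜) • A) (A x - z)) (A x - z)
    have h3 := norm_exp_smul_apply_sub_le hA z hs.1
    have h4 := mul_le_mul_of_nonneg_left hs.2.le (norm_nonneg (A z))
    refine (norm_add_le _ _).trans ?_
    linarith

end ExpOrbit

/-! ### Strong limits of contraction semigroups. -/

/-- Uniformly bounded operators converging on a dense set converge everywhere. -/
theorem exists_tendsto_of_denseRange {𝕜 X Y : Type*} [RCLike 𝕜] [NormedAddCommGroup X]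
    [NormedSpace 𝕜 X] [CompleteSpace X] {E : ℕ → X →L[𝕜] X} (hE : ∀ n, ‖E n‖ ≤ 1) {W : Y → X}
    (hW : DenseRange W) (h : ∀ y, CauchySeq fun n => E n (W y)) (x : X) :
    ∃ l, Tendsto (fun n => E n x) atTop (𝓝 l) := by
  refine cauchySeq_tendsto_of_complete (Metric.cauchySeq_iff'.2 fun ε hε => ?_)
  obtain ⟨y, hy⟩ := hW.exists_dist_lt x (show 0 < ε / 3 by positivity)
  obtain ⟨N, hN⟩ := Metric.cauchySeq_iff'.1 (h y) (ε / 3) (by positivity)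
  refine ⟨N, fun n hn => ?_⟩
  have hd : ∀ m, dist (E m x) (E m (W y)) ≤ dist x (W y) := fun m => by
    simpa [dist_eq_norm] using (E m).le_of_opNorm_le (hE m) (x - W y)
  have h1 := hd n
  have h2 := hd N
  have h3 := hN n hn
  have h4 := dist_triangle4 (E n x) (E n (W y)) (E N (W y)) (E N x)
  rw [dist_comm (E N (W y))] at h4
  linarith

namespace C0Semigroup

variable {𝕜 X : Type*} [RCLike 𝕜] [NormedAddCommGroup X] [NormedSpace 𝕜 X] [CompleteSpace X]

/-- A strong limit of the contraction semigroups `exp (t A n)`, where the bounded operators `A n`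
commute and converge pointwise on a dense set. -/
theorem exists_isContraction_of_tendsto {A : ℕ → X →L[𝕜] X} (hc : ∀ m n, Commute (A m) (A n))
    (hA : ∀ n (s : ℝ), 0 ≤ s → ‖NormedSpace.exp ((s : 𝕜) • A n)‖ ≤ 1) {Y : Type*} {W U : Y → X}
    (hW : DenseRange W) (hlim : ∀ y, Tendsto (fun n => A n (W y)) atTop (𝓝 (U y))) :
    ∃ T : C0Semigroup 𝕜 X, T.IsContraction ∧
      ∀ y, Tendsto (T.diffQuot (W y)) (𝓝[>] 0) (𝓝 (U y)) := by
  have hcau : ∀ (t : ℝ≥0) (y : Y),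
      CauchySeq fun n => NormedSpace.exp (((t : ℝ) : 𝕜) • A n) (W y) := by
    intro t y
    refine Metric.cauchySeq_iff'.2 fun ε hε => ?_
    obtain ⟨N, hN⟩ := Metric.cauchySeq_iff'.1 (hlim y).cauchySeq (ε / (t + 1)) (by positivity)
    refine ⟨N, fun n hn => ?_⟩
    have h1 := norm_exp_smul_apply_sub_exp_smul_apply_le (hc n N) (hA n) (hA N) (W y) t.2
    rw [← dist_eq_norm, ← dist_eq_norm] at h1
    have h2 := (lt_div_iff₀ (by positivity)).1 (hN n hn)
    have h3 : 0 ≤ dist (A n (W y)) (A N (W y)) := dist_nonneg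
    refine h1.trans_lt (lt_of_le_of_lt ?_ h2)
    exact mul_le_mul_of_nonneg_left (le_add_of_nonneg_right zero_le_one) h3
  choose L hL using fun (t : ℝ≥0) (x : X) =>
    exists_tendsto_of_denseRange (fun n => hA n t t.2) hW (hcau t) x
  have hbound : ∀ t x, ‖L t x‖ ≤ 1 * ‖x‖ := fun t x =>
    le_of_tendsto (hL t x).norm (Eventually.of_forall fun n =>
      (NormedSpace.exp (((t : ℝ) : 𝕜) • A n)).le_of_opNorm_le (hA n t t.2) x)
  let S : ℝ≥0 → X →L[𝕜] X := fun t => LinearMap.mkContinuous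
    { toFun := L t
      map_add' := fun x y => tendsto_nhds_unique (hL t (x + y)) (by
        simpa only [map_add] using (hL t x).add (hL t y))
      map_smul' := fun c x => tendsto_nhds_unique (hL t (c • x)) (by
        simpa only [map_smul, RingHom.id_apply] using (hL t x).const_smul c) } 1 (hbound t)
  have hS : ∀ (t : ℝ≥0) (x : X),
      Tendsto (fun n => NormedSpace.exp (((t : ℝ) : 𝕜) • A n) x) atTop (𝓝 (S t x)) :=
    hL
  have hSn : ∀ t, ‖S t‖ ≤ 1 := fun t => LinearMap.mkContinuous_norm_le _ zero_le_one _
  have hS0 : S 0 = ContinuousLinearMap.id 𝕜 X := by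
    ext x
    refine tendsto_nhds_unique (hS 0 x) ?_
    simp
  have hSadd : ∀ s t, S (s + t) = (S s).comp (S t) := by
    intro s t
    ext x
    refine tendsto_nhds_unique (hS (s + t) x) ?_
    rw [tendsto_iff_norm_sub_tendsto_zero]
    have h1 := tendsto_iff_norm_sub_tendsto_zero.1 (hS s (S t x))
    have h2 := tendsto_iff_norm_sub_tendsto_zero.1 (hS t x)
    refine squeeze_zero (fun _ => norm_nonneg _) (fun n => ?_) (by simpa using h2.add h1)
    have e : NormedSpace.exp ((((s + t : ℝ≥0) : ℝ) : 𝕜) • A n) x =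
        NormedSpace.exp (((s : ℝ) : 𝕜) • A n) (NormedSpace.exp (((t : ℝ) : 𝕜) • A n) x) := by
      rw [← mul_apply_eq_comp, ← exp_add_of_commute_clm
        (((Commute.refl (A n)).smul_left _).smul_right _), ← add_smul]
      push_cast
      rfl
    rw [e, ContinuousLinearMap.comp_apply]
    refine (norm_sub_le_norm_sub_add_norm_sub _
      (NormedSpace.exp (((s : ℝ) : 𝕜) • A n) (S t x)) _).trans ?_
    rw [← map_sub]
    gcongr
    exact ((NormedSpace.exp (((s : ℝ) : 𝕜) • A n)).le_of_opNorm_le (hA n s s.2) _).trans_eq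
      (one_mul _)
  have hlip : ∀ t y, ‖S t (W y) - W y‖ ≤ ‖U y‖ * t := fun t y =>
    le_of_tendsto_of_tendsto ((hS t (W y)).sub_const _).norm ((hlim y).norm.mul_const _)
      (Eventually.of_forall fun n => norm_exp_smul_apply_sub_le (hA n) (W y) t.2)
  have hlip' : ∀ y, LipschitzWith ‖U y‖₊ fun t => S t (W y) := by
    intro y
    have aux : ∀ s t : ℝ≥0, s ≤ t → dist (S s (W y)) (S t (W y)) ≤ ‖U y‖ * dist s t := by
      intro s t hst
      obtain ⟨r, rfl⟩ := exists_add_of_le hst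
      rw [hSadd, ContinuousLinearMap.comp_apply, dist_comm, dist_eq_norm, ← map_sub]
      refine ((S s).le_of_opNorm_le (hSn s) _).trans ?_
      simpa [NNReal.dist_eq] using hlip r y
    refine LipschitzWith.of_dist_le_mul fun s t => ?_
    rcases le_total s t with h | h
    · exact aux s t h
    · rw [dist_comm, dist_comm s t]
      exact aux t s h
  have hcont : ∀ x, Continuous fun t => S t x := by
    intro x
    refine continuous_of_uniform_approx_of_continuous fun u hu => ?_
    obtain ⟨ε, hε, hεu⟩ := Metric.mem_uniformity_dist.1 hu
    obtain ⟨y, hy⟩ := hW.exists_dist_lt x hε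
    refine ⟨fun t => S t (W y), (hlip' y).continuous, fun t => hεu (lt_of_le_of_lt ?_ hy)⟩
    simpa [dist_eq_norm] using (S t).le_of_opNorm_le (hSn t) (x - W y)
  have htay : ∀ t y z, ‖S t (W y) - W y - ((t : ℝ) : 𝕜) • U y‖ ≤
      (2 * ‖U y - W z‖ + ‖U z‖ * t) * t := fun t y z =>
    le_of_tendsto_of_tendsto (((hS t (W y)).sub_const _).sub ((hlim y).const_smul _)).norm
      (((((hlim y).sub_const _).norm.const_mul _).add ((hlim z).norm.mul_const _)).mul_const _)
      (Eventually.of_forall fun n => norm_exp_smul_apply_sub_sub_le (hA n) (W y) (W z) t.2)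
  refine ⟨⟨S, hS0, hSadd, hcont⟩, hSn, fun y => Metric.tendsto_nhds.2 fun ε hε => ?_⟩
  -- In `htay`, divided by `t`, the term `2 * ‖U y - W z‖` stays below `ε / 2`, and small `t`
  -- handles the other half.
  obtain ⟨z, hz⟩ := hW.exists_dist_lt (U y) (show 0 < ε / 4 by positivity)
  rw [dist_eq_norm] at hz
  have hev : ∀ᶠ t : ℝ≥0 in 𝓝[>] 0, ‖U z‖ * t < ε / 2 := by
    have : Tendsto (fun t : ℝ≥0 => ‖U z‖ * (t : ℝ)) (𝓝[>] 0) (𝓝 (‖U z‖ * ((0 : ℝ≥0) : ℝ))) :=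
      ((NNReal.continuous_coe.const_mul _).tendsto _).mono_left nhdsWithin_le_nhds
    refine this.eventually_lt_const ?_
    simpa using hε
  filter_upwards [hev, self_mem_nhdsWithin] with t ht ht0
  have ht0' : (0 : ℝ) < t := ht0
  have htk : ((t : ℝ) : 𝕜) ≠ 0 := by exact_mod_cast ht0'.ne'
  have e : diffQuot ⟨S, hS0, hSadd, hcont⟩ (W y) t - U y =
      (((t : ℝ) : 𝕜)⁻¹) • (S t (W y) - W y - ((t : ℝ) : 𝕜) • U y) := by
    rw [smul_sub _ (S t (W y) - W y), inv_smul_smul₀ htk]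
    rfl
  rw [dist_eq_norm, e, norm_smul, norm_inv, RCLike.norm_ofReal, abs_of_pos ht0',
    inv_mul_lt_iff₀ ht0', mul_comm]
  refine (htay t y z).trans_lt ?_
  gcongr
  linarith

end C0Semigroup

/-! ### Dissipativity and dense domain of the generator. -/

namespace C0Semigroup

variable {𝕜 X : Type*} [RCLike 𝕜] [NormedAddCommGroup X] [NormedSpace 𝕜 X]

theorem tendsto_diffQuot_generator (T : C0Semigroup 𝕜 X) (x : T.generator.domain) :
    Tendsto (T.diffQuot x) (𝓝[>] 0) (𝓝 (T.generator x)) :=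
  x.2.choose_spec

theorem exists_generator_eq (T : C0Semigroup 𝕜 X) {x y : X}
    (h : Tendsto (T.diffQuot x) (𝓝[>] 0) (𝓝 y)) :
    ∃ hx : x ∈ T.generator.domain, T.generator ⟨x, hx⟩ = y :=
  ⟨⟨y, h⟩, tendsto_nhds_unique (T.tendsto_diffQuot_generator ⟨x, ⟨y, h⟩⟩) h⟩

/-- The generator of a contraction semigroup is dissipative. -/
theorem IsContraction.mul_norm_le {T : C0Semigroup 𝕜 X} (hT : T.IsContraction)
    (x : T.generator.domain) {c : ℝ} (hc : 0 ≤ c) :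
    c * ‖(x : X)‖ ≤ ‖(c : 𝕜) • (x : X) - T.generator x‖ := by
  refine ge_of_tendsto ((T.tendsto_diffQuot_generator x).const_sub ((c : 𝕜) • (x : X))).norm ?_
  filter_upwards [self_mem_nhdsWithin] with h hh
  have hh' : (0 : ℝ) < h := hh
  -- Since `‖T(h) x‖ ≤ ‖x‖`, the reverse triangle inequality costs at most `h⁻¹ ‖x‖`, leaving `c
  -- ‖x‖`.
  have e : (c : 𝕜) • (x : X) - T.diffQuot x h =
      ((c + (h : ℝ)⁻¹ : ℝ) : 𝕜) • (x : X) - (((h : ℝ)⁻¹ : ℝ) : 𝕜) • T.op h x := by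
    simp only [diffQuot]
    push_cast
    module
  rw [e]
  refine le_trans ?_ (norm_sub_norm_le _ _)
  rw [norm_smul, norm_smul, RCLike.norm_ofReal, RCLike.norm_ofReal, abs_of_nonneg (by positivity),
    abs_of_nonneg (by positivity)]
  have h1 := mul_le_mul_of_nonneg_left ((T.op h).le_of_opNorm_le (hT h) x) (inv_nonneg.2 hh'.le)
  linarith

variable [CompleteSpace X]

/-- The generator of a `C₀`-semigroup is densely defined. -/
theorem dense_generatorDomain (T : C0Semigroup 𝕜 X) : Dense (T.generatorDomain : Set X) := by
  let : NormedSpace ℝ X := NormedSpace.restrictScalars ℝ 𝕜 X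
  intro x
  let u : ℝ → X := fun s => T.op s.toNNReal x
  have hu : Continuous u := (T.continuous_orbit x).comp continuous_real_toNNReal
  have hu0 : u 0 = x := by simp [u, T.op_zero]
  -- The averages `r⁻¹ • F r` converge to `x` and lie in the domain: by `hshift` the difference
  -- quotient of `F t` is a difference of two quotients of `F`, with limit `u t - u 0`.
  let F : ℝ → X := fun t => ∫ s in (0 : ℝ)..t, u s
  have hF0 : F 0 = 0 := intervalIntegral.integral_same
  have hF : ∀ t, HasDerivAt F (u t) t := fun t => hu.integral_hasStrictDerivAt 0 t |>.hasDerivAt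
  have hquot : ∀ t, Tendsto (fun r : ℝ≥0 => (r : ℝ)⁻¹ • (F (t + r) - F t)) (𝓝[>] 0) (𝓝 (u t)) := by
    intro t
    refine (hasDerivAt_iff_tendsto_slope_zero.1 (hF t)).comp ?_
    refine tendsto_nhdsWithin_iff.2 ⟨?_, ?_⟩
    · exact (NNReal.continuous_coe.tendsto 0).mono_left nhdsWithin_le_nhds
    · filter_upwards [self_mem_nhdsWithin] with r hr
      exact (NNReal.coe_pos.2 hr).ne'
  have hshift : ∀ (t : ℝ) (r : ℝ≥0), 0 ≤ t → T.op r (F t) = F (t + r) - F r := by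
    intro t r ht
    have h1 : T.op r (F t) = ∫ s in (0 : ℝ)..t, T.op r (u s) :=
      (((T.op r).restrictScalars ℝ).intervalIntegral_comp_comm
        (hu.intervalIntegrable 0 t)).symm
    have h2 : ∫ s in (0 : ℝ)..t, T.op r (u s) = ∫ s in (0 : ℝ)..t, u (s + r) := by
      refine intervalIntegral.integral_congr fun s hs => ?_
      rw [Set.uIcc_of_le ht] at hs
      simp only [u]
      rw [Real.toNNReal_add hs.1 r.coe_nonneg, Real.toNNReal_coe, add_comm, T.op_add]
      rfl
    rw [h1, h2, intervalIntegral.integral_comp_add_right, zero_add]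
    exact (intervalIntegral.integral_interval_sub_left
      (hu.intervalIntegrable _ _) (hu.intervalIntegrable _ _)).symm
  have hreal : ∀ (r : ℝ) (z : X), ((r : 𝕜)⁻¹) • z = r⁻¹ • z := by
    intro r z
    rw [← RCLike.ofReal_inv, RCLike.real_smul_eq_coe_smul (K := 𝕜)]
  have hmem : ∀ t : ℝ, 0 ≤ t → F t ∈ T.generatorDomain := by
    intro t ht
    refine ⟨u t - u 0, ((hquot t).sub (hquot 0)).congr fun r => ?_⟩
    simp only [diffQuot]
    rw [hshift t r ht, hreal, ← smul_sub, zero_add, hF0]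
    congr 1
    abel
  refine mem_closure_of_tendsto (b := 𝓝[>] (0 : ℝ≥0)) (by simpa only [hu0] using hquot 0)
    (Eventually.of_forall fun r => ?_)
  rw [zero_add, hF0, sub_zero, ← hreal]
  exact T.generatorDomain.smul_mem _ (hmem r r.2)

end C0Semigroup

/-! ### Cogenerators and resolvents. -/

section

variable {𝕜 X : Type*} [RCLike 𝕜] [NormedAddCommGroup X] [NormedSpace 𝕜 X]

theorem algebraMap_sub_apply (c : 𝕜) (V : X →L[𝕜] X) (y : X) :
    (algebraMap 𝕜 (X →L[𝕜] X) c - V) y = c • y - V y := by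
  simp [Algebra.algebraMap_eq_smul_one]

/-- `(A + 1) R = (A - 1) R + 2 R`. Thus `V - 1 = 2 R` is injective with range the domain of `A`. -/
theorem IsCogenerator.exists_resolvent {V : X →L[𝕜] X} {T : C0Semigroup 𝕜 X}
    (h : IsCogenerator V T) :
    ∃ R : X →L[𝕜] X, IsShiftInverse T.generator 1 R ∧ V = 1 + (2 : 𝕜) • R := by
  obtain ⟨R, hR, hV⟩ := h
  refine ⟨R, hR, ContinuousLinearMap.ext fun y => ?_⟩
  obtain ⟨h1, e1⟩ := hR.1 y
  obtain ⟨h2, e2⟩ := hV y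
  rw [one_smul, sub_eq_iff_eq_add] at e1
  rw [e2, e1]
  simp only [add_apply, one_apply_eq_self, smul_apply]
  module

theorem IsCogenerator.injective_sub_one {V : X →L[𝕜] X} {T : C0Semigroup 𝕜 X}
    (h : IsCogenerator V T) : Function.Injective (V - 1 : X →L[𝕜] X) := by
  obtain ⟨R, hR, rfl⟩ := h.exists_resolvent
  refine (injective_iff_map_eq_zero _).2 fun y hy => ?_
  obtain ⟨h1, e1⟩ := hR.1 y
  have hy' : R y = 0 := by simpa using hy
  have h0 : (⟨R y, h1⟩ : T.generator.domain) = 0 := Subtype.ext hy'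
  rw [h0, hy', LinearPMap.map_zero, smul_zero, sub_zero] at e1
  exact e1.symm

theorem IsCogenerator.denseRange_sub_one [CompleteSpace X] {V : X →L[𝕜] X} {T : C0Semigroup 𝕜 X}
    (h : IsCogenerator V T) : DenseRange (V - 1 : X →L[𝕜] X) := by
  obtain ⟨R, hR, rfl⟩ := h.exists_resolvent
  refine T.dense_generatorDomain.mono fun x hx => ?_
  refine ⟨(2 : 𝕜)⁻¹ • (T.generator ⟨x, hx⟩ - (1 : 𝕜) • x), ?_⟩
  have := hR.2 ⟨x, hx⟩
  rw [add_sub_cancel_left, map_smul, smul_apply, this, inv_smul_smul₀ two_ne_zero]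

/-- This is dissipativity of `A` at `λ = (μ + 1)/(μ - 1)`, tested on `R y`. -/
theorem IsCogenerator.norm_one_sub_apply_le {V : X →L[𝕜] X} {T : C0Semigroup 𝕜 X}
    (h : IsCogenerator V T) (hT : T.IsContraction) {μ : ℝ} (hμ : 1 < μ) (y : X) :
    (μ + 1) * ‖(1 - V) y‖ ≤ 2 * ‖(algebraMap 𝕜 (X →L[𝕜] X) μ - V) y‖ := by
  obtain ⟨R, hR, rfl⟩ := h.exists_resolvent
  obtain ⟨h1, e1⟩ := hR.1 y
  rw [one_smul, sub_eq_iff_eq_add] at e1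
  have hμ' : 0 < μ - 1 := sub_pos.2 hμ
  have hμk : (μ : 𝕜) - 1 ≠ 0 := by exact_mod_cast hμ'.ne'
  have hd := hT.mul_norm_le ⟨R y, h1⟩ (c := (μ + 1) / (μ - 1)) (by positivity)
  rw [e1] at hd
  have e2 : ((((μ + 1) / (μ - 1) : ℝ)) : 𝕜) • R y - (y + R y) =
      -(((μ - 1)⁻¹ : ℝ) : 𝕜) • (algebraMap 𝕜 (X →L[𝕜] X) μ - (1 + (2 : 𝕜) • R)) y := by
    rw [algebraMap_sub_apply]
    simp only [add_apply, smul_apply, one_apply_eq_self]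
    push_cast
    match_scalars <;> field_simp <;> ring
  have e3 : (1 - (1 + (2 : 𝕜) • R)) y = -((2 : 𝕜) • R y) := by simp
  rw [e2, norm_smul, norm_neg, RCLike.norm_ofReal, abs_of_pos (by positivity), div_mul_eq_mul_div,
    inv_mul_eq_div, div_le_div_iff_of_pos_right hμ'] at hd
  rw [e3, norm_neg, norm_smul, RCLike.norm_ofNat]
  linarith

/-- An operator bounded below along a half line has this half line in its resolvent set. -/
theorem mem_resolventSet_of_mul_norm_le [CompleteSpace X] {V : X →L[𝕜] X}
    (h : ∀ μ : ℝ, 1 < μ → ∀ y, (μ - 1) * ‖y‖ ≤ 2 * ‖(algebraMap 𝕜 (X →L[𝕜] X) μ - V) y‖)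
    {μ : ℝ} (hμ : 1 < μ) : (μ : 𝕜) ∈ resolventSet 𝕜 V := by
  rcases subsingleton_or_nontrivial X with hX | hX
  · exact isUnit_of_subsingleton _
  -- The resolvent set is open and contains all large `μ`. The lower bound makes it relatively
  -- closed in the connected set `(1, ∞)`.
  have hsub : Set.Ioi (1 : ℝ) ⊆ (fun ν : ℝ => (ν : 𝕜)) ⁻¹' resolventSet 𝕜 V := by
    refine isPreconnected_Ioi.subset_of_closure_inter_subset
      ((spectrum.isOpen_resolventSet V).preimage RCLike.continuous_ofReal) ?_ ?_
    · refine ⟨‖V‖ + 2, Set.mem_Ioi.2 (by linarith [norm_nonneg V]),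
        spectrum.mem_resolventSet_of_norm_lt_mul ?_⟩
      rw [RCLike.norm_ofReal, norm_one, mul_one, abs_of_pos (by positivity)]
      linarith
    · rintro ν ⟨hν, hν1⟩
      have hν1' : 1 < ν := hν1
      -- With `|ν - κ| < (ν - 1)/4` one gets `(κ - 1)/2 > 3(ν - 1)/8 > |ν - κ|`, so the inverse at
      -- `κ`, of norm at most `2/(κ - 1)`, survives the perturbation to `ν`.
      obtain ⟨κ, hκ, hd⟩ := Metric.mem_closure_iff.1 hν ((ν - 1) / 4) (by linarith)
      rw [Real.dist_eq] at hd
      have hd' := abs_lt.1 hd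
      have hκ1 : 1 < κ := by linarith
      obtain ⟨a, ha⟩ := (show IsUnit (algebraMap 𝕜 (X →L[𝕜] X) κ - V) from hκ)
      have hinv : ‖((a⁻¹ : (X →L[𝕜] X)ˣ) : X →L[𝕜] X)‖ ≤ 2 / (κ - 1) := by
        refine ContinuousLinearMap.opNorm_le_bound _ (by
          have := sub_pos.2 hκ1
          positivity) fun z => ?_
        have h1 := h κ hκ1 (((a⁻¹ : (X →L[𝕜] X)ˣ) : X →L[𝕜] X) z)
        rw [← ha, ← mul_apply_eq_comp, a.mul_inv, one_apply_eq_self] at h1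
        rw [div_mul_eq_mul_div, le_div_iff₀ (sub_pos.2 hκ1)]
        linarith
      have hnear : ‖(algebraMap 𝕜 (X →L[𝕜] X) ν - V) - a‖ <
          ‖((a⁻¹ : (X →L[𝕜] X)ˣ) : X →L[𝕜] X)‖⁻¹ := by
        refine lt_of_lt_of_le ?_ (inv_anti₀ (Units.norm_pos _) hinv)
        rw [ha, sub_sub_sub_cancel_right, ← map_sub, norm_algebraMap', ← RCLike.ofReal_sub,
          RCLike.norm_ofReal, inv_div]
        linarith
      exact (a.ofNearby _ hnear).isUnit
  exact hsub hμ

theorem norm_mul_resolvent_le [CompleteSpace X] {V B : X →L[𝕜] X} {μ : 𝕜}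
    (hμ : μ ∈ resolventSet 𝕜 V) {C : ℝ} (hC : 0 ≤ C)
    (h : ∀ y, ‖B y‖ ≤ C * ‖(algebraMap 𝕜 (X →L[𝕜] X) μ - V) y‖) :
    ‖B * resolvent V μ‖ ≤ C := by
  refine ContinuousLinearMap.opNorm_le_bound _ hC fun z => ?_
  have h1 := h (resolvent V μ z)
  rwa [resolvent, ← mul_apply_eq_comp (algebraMap 𝕜 (X →L[𝕜] X) μ - V),
    Ring.mul_inverse_cancel _ hμ, one_apply_eq_self] at h1

theorem tendsto_of_denseRange {Y : Type*} {E : ℕ → X →L[𝕜] X} (hE : ∀ n, ‖E n‖ ≤ 1) {W : Y → X}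
    (hW : DenseRange W) (h : ∀ y, Tendsto (fun n => E n (W y)) atTop (𝓝 (W y))) (x : X) :
    Tendsto (fun n => E n x) atTop (𝓝 x) := by
  refine Metric.tendsto_nhds.2 fun ε hε => ?_
  obtain ⟨y, hy⟩ := hW.exists_dist_lt x (show 0 < ε / 3 by positivity)
  filter_upwards [Metric.tendsto_nhds.1 (h y) (ε / 3) (by positivity)] with n hn
  have h1 : dist (E n x) (E n (W y)) ≤ dist x (W y) := by
    simpa [dist_eq_norm] using (E n).le_of_opNorm_le (hE n) (x - W y)
  have h4 := dist_triangle4 (E n x) (E n (W y)) (W y) x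
  rw [dist_comm (W y)] at h4
  linarith

theorem commute_resolvent {V B : X →L[𝕜] X} (h : Commute V B) {μ : 𝕜}
    (hμ : μ ∈ resolventSet 𝕜 V) : Commute B (resolvent V μ) := by
  obtain ⟨a, ha⟩ := (show IsUnit (algebraMap 𝕜 (X →L[𝕜] X) μ - V) from hμ)
  rw [resolvent, ← ha, Ring.inverse_unit]
  refine Commute.units_inv_right ?_
  rw [ha]
  exact (Algebra.commute_algebraMap_right μ B).sub_right h.symm

/-- The generator of a contraction semigroup that maps `(V - 1) y` to `(V + 1) y` is
`(V + 1) (V - 1)⁻¹`. -/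
theorem isCogenerator_of_tendsto {V : X →L[𝕜] X} {T : C0Semigroup 𝕜 X} (hT : T.IsContraction)
    (h : ∀ y, Tendsto (T.diffQuot ((V - 1) y)) (𝓝[>] 0) (𝓝 ((V + 1) y))) :
    IsCogenerator V T := by
  have hgen : ∀ y, ∃ hy : ((2 : 𝕜)⁻¹ • (V - 1)) y ∈ T.generator.domain,
      T.generator ⟨((2 : 𝕜)⁻¹ • (V - 1)) y, hy⟩ = (2 : 𝕜)⁻¹ • (V + 1) y := fun y =>
    T.exists_generator_eq (T.tendsto_diffQuot_smul _ (h y))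
  have hhalf : ∀ y : X, (2 : 𝕜)⁻¹ • (V + 1) y - ((2 : 𝕜)⁻¹ • (V - 1)) y = y := by
    intro y
    simp only [add_apply, smul_apply, sub_apply, one_apply_eq_self]
    match_scalars <;> field_simp <;> ring
  refine ⟨(2 : 𝕜)⁻¹ • (V - 1), ⟨fun y => ?_, fun x => ?_⟩, fun y => ?_⟩
  · obtain ⟨hy, e⟩ := hgen y
    exact ⟨hy, by rw [e, one_smul, hhalf]⟩
  · obtain ⟨w, hw⟩ : ∃ w, w = T.generator x - (1 : 𝕜) • (x : X) := ⟨_, rfl⟩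
    rw [← hw]
    obtain ⟨hy, e⟩ := hgen w
    have e' := hhalf w
    rw [← e] at e'
    replace e' := e'.trans hw
    rw [one_smul] at e'
    -- Dissipativity with `c = 1` makes `A - 1` injective, and it takes the same value `w` at both
    -- points.
    have hd := hT.mul_norm_le (⟨_, hy⟩ - x) zero_le_one
    rw [LinearPMap.map_sub, Submodule.coe_sub, RCLike.ofReal_one, one_smul, one_mul] at hd
    have h0 : ((2 : 𝕜)⁻¹ • (V - 1)) w - (x : X) - (T.generator ⟨_, hy⟩ - T.generator x) = 0 := by
      rw [sub_sub_sub_comm, ← neg_sub (T.generator ⟨_, hy⟩), e']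
      abel
    rw [h0, norm_zero] at hd
    exact sub_eq_zero.1 (norm_le_zero_iff.1 hd)
  · obtain ⟨hy, e⟩ := hgen y
    refine ⟨hy, ?_⟩
    rw [e]
    simp only [add_apply, smul_apply, sub_apply, one_apply_eq_self]
    match_scalars <;> field_simp <;> ring

end

/-! ### Yosida approximation in terms of the cogenerator. -/

section

variable {𝕜 X : Type*} [RCLike 𝕜] [NormedAddCommGroup X] [NormedSpace 𝕜 X]

/-- The generation theorem in terms of the cogenerator: the operators
`(μ n + 1) / (μ n - 1) * (J n - 1)`, with `J n = (μ n + 1) / 2 * (1 - V) * (μ n - V)⁻¹`, are the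
Yosida approximations of `(V + 1) (V - 1)⁻¹`. -/
theorem exists_isCogenerator_of_norm_le [CompleteSpace X] {V : X →L[𝕜] X}
    (hV : DenseRange (V - 1 : X →L[𝕜] X)) {μ : ℕ → ℝ} (hμ : ∀ n, 1 < μ n)
    (hlim : Tendsto μ atTop (𝓝 1)) (hres : ∀ n, (μ n : 𝕜) ∈ resolventSet 𝕜 V)
    (hbd : ∀ n, ‖(1 - V) * resolvent V (μ n : 𝕜)‖ ≤ 2 / (μ n + 1)) :
    ∃ T : C0Semigroup 𝕜 X, T.IsContraction ∧ IsCogenerator V T := by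
  let R : ℕ → X →L[𝕜] X := fun n => resolvent V (μ n : 𝕜)
  have hcR : ∀ {B : X →L[𝕜] X}, Commute V B → ∀ n, Commute B (R n) := fun h n =>
    commute_resolvent h (hres n)
  let J : ℕ → X →L[𝕜] X := fun n => (((μ n + 1) / 2 : ℝ) : 𝕜) • ((1 - V) * R n)
  -- `c n` is the `λ` belonging to `μ n`, and `J n` plays the role of `λ R(λ, A)`.
  let c : ℕ → ℝ := fun n => (μ n + 1) / (μ n - 1)
  have hc : ∀ n, 0 < c n := fun n =>
    div_pos (by linarith [hμ n]) (sub_pos.2 (hμ n))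
  let A : ℕ → X →L[𝕜] X := fun n => (c n : 𝕜) • (J n - 1)
  have hJ : ∀ n, ‖J n‖ ≤ 1 := by
    intro n
    have h0 : 0 < μ n + 1 := by linarith [hμ n]
    rw [norm_smul, RCLike.norm_ofReal, abs_of_pos (by positivity)]
    calc (μ n + 1) / 2 * ‖(1 - V) * R n‖ ≤ (μ n + 1) / 2 * (2 / (μ n + 1)) := by
          gcongr
          exact hbd n
      _ = 1 := by field_simp
  have hV1 : Commute V (1 - V) := (Commute.one_right V).sub_right (Commute.refl V)
  have hcVJ : ∀ n, Commute V (J n) := fun n =>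
    (hV1.mul_right (hcR (Commute.refl V) n)).smul_right _
  have hcJJ : ∀ m n, Commute (J m) (J n) := fun m n =>
    ((((Commute.one_right (J m)).sub_right (hcVJ m).symm)).mul_right
      (hcR (hcVJ m) n)).smul_right _
  have hcA : ∀ m n, Commute (A m) (A n) := fun m n =>
    (((((hcJJ m n).sub_left (Commute.one_left _))).sub_right
      (Commute.one_right _)).smul_left _).smul_right _
  have hexp : ∀ n (s : ℝ), 0 ≤ s → ‖NormedSpace.exp ((s : 𝕜) • A n)‖ ≤ 1 := by
    intro n s hs
    have e : (s : 𝕜) • A n = ((s * c n : ℝ) : 𝕜) • (J n - 1) := by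
      simp only [A]
      rw [smul_smul, RCLike.ofReal_mul]
    rw [e]
    exact norm_exp_smul_sub_one_le (hJ n) (mul_nonneg hs (hc n).le)
  have hJ1 : ∀ n, J n - 1 = -(((μ n - 1) / 2 : ℝ) : 𝕜) • ((1 + V) * R n) := by
    intro n
    have hM : (algebraMap 𝕜 (X →L[𝕜] X) (μ n) - V) * R n = 1 := Ring.mul_inverse_cancel _ (hres n)
    simp only [J]
    nth_rw 2 [← hM]
    rw [← smul_mul_assoc, ← smul_mul_assoc, ← sub_mul]
    congr 1
    ext y
    rw [sub_apply, algebraMap_sub_apply]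
    simp only [smul_apply, add_apply, sub_apply, one_apply_eq_self]
    push_cast
    match_scalars <;> field_simp <;> ring
  -- The Yosida identity `A n x = J n (A x)` at `x = (V - 1) y`, where `A x = (V + 1) y`.
  have hAV : ∀ n, A n * (V - 1) = J n * (V + 1) := by
    intro n
    have hμk : (μ n : 𝕜) - 1 ≠ 0 := by exact_mod_cast (sub_pos.2 (hμ n)).ne'
    have hs : (c n : 𝕜) * -(((μ n - 1) / 2 : ℝ) : 𝕜) = -(((μ n + 1) / 2 : ℝ) : 𝕜) := by
      simp only [c]
      push_cast
      field_simp
    simp only [A]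
    rw [hJ1, smul_smul, hs]
    simp only [J]
    rw [neg_smul, ← smul_neg, smul_mul_assoc, smul_mul_assoc, neg_mul, mul_assoc, mul_assoc,
      ← (hcR ((Commute.refl V).sub_right (Commute.one_right V)) n).eq,
      ← (hcR ((Commute.refl V).add_right (Commute.one_right V)) n).eq, ← mul_assoc, ← mul_assoc,
      ← neg_mul]
    congr 2
    noncomm_ring
  have hAV' : ∀ n y, A n ((V - 1) y) = J n ((V + 1) y) := fun n y =>
    DFunLike.congr_fun (hAV n) y
  have hcinv : Tendsto (fun n => (c n)⁻¹) atTop (𝓝 0) := by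
    have : Tendsto (fun n => (μ n - 1) / (μ n + 1)) atTop (𝓝 ((1 - 1) / (1 + 1))) :=
      (hlim.sub_const 1).div (hlim.add_const 1) (by norm_num)
    simpa [c] using this
  -- On the range of `V - 1`, `J n x - x = (c n)⁻¹ • A n x` has norm at most `(c n)⁻¹ ‖(V + 1) y‖`,
  -- and `c n → ∞`.
  have hJlim : ∀ x, Tendsto (fun n => J n x) atTop (𝓝 x) := by
    refine tendsto_of_denseRange hJ hV fun y => ?_
    rw [tendsto_iff_norm_sub_tendsto_zero]
    refine squeeze_zero (fun _ => norm_nonneg _) (fun n => ?_)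
      (by simpa only [zero_mul] using hcinv.mul_const ‖(V + 1) y‖)
    have e : J n ((V - 1) y) - (V - 1) y = (((c n)⁻¹ : ℝ) : 𝕜) • A n ((V - 1) y) := by
      have hck : (c n : 𝕜) ≠ 0 := by exact_mod_cast (hc n).ne'
      rw [RCLike.ofReal_inv, eq_inv_smul_iff₀ hck]
      rfl
    rw [e, hAV', norm_smul, RCLike.norm_ofReal, abs_of_pos (inv_pos.2 (hc n))]
    refine mul_le_mul_of_nonneg_left ?_ (inv_nonneg.2 (hc n).le)
    simpa only [one_mul] using (J n).le_of_opNorm_le (hJ n) _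
  obtain ⟨T, hT, hgen⟩ := C0Semigroup.exists_isContraction_of_tendsto hcA hexp hV
    (U := fun y => (V + 1) y) fun y => by
      simpa only [hAV'] using hJlim ((V + 1) y)
  exact ⟨T, hT, isCogenerator_of_tendsto hT hgen⟩

end

/-! ### The equivalence. -/

theorem theorem2p2 {𝕜 X : Type*} [RCLike 𝕜] [NormedAddCommGroup X] [NormedSpace 𝕜 X]
    [CompleteSpace X] (V : X →L[𝕜] X) :
    List.TFAE [
      ∃ T : C0Semigroup 𝕜 X, T.IsContraction ∧ IsCogenerator V T,
      Function.Injective (V - 1 : X →L[𝕜] X) ∧ DenseRange (V - 1 : X →L[𝕜] X) ∧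
        (∀ μ : ℝ, 1 < μ → (μ : 𝕜) ∈ resolventSet 𝕜 V) ∧
        ∀ μ : ℝ, 1 < μ → ‖(1 - V) * resolvent V (μ : 𝕜)‖ ≤ 2 / (μ + 1),
      Function.Injective (V - 1 : X →L[𝕜] X) ∧ DenseRange (V - 1 : X →L[𝕜] X) ∧
        ∃ μ₀ : ℝ, 1 < μ₀ ∧
          (∀ μ : ℝ, 1 < μ → μ < μ₀ → (μ : 𝕜) ∈ resolventSet 𝕜 V) ∧
          ∀ μ : ℝ, 1 < μ → μ < μ₀ → ‖(1 - V) * resolvent V (μ : 𝕜)‖ ≤ 2 / (μ + 1)] := by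

  tfae_have 1 → 2 := by
    rintro ⟨T, hT, hV⟩
    have hres : ∀ μ : ℝ, 1 < μ → (μ : 𝕜) ∈ resolventSet 𝕜 V := fun μ hμ => by
      refine mem_resolventSet_of_mul_norm_le (fun ν hν y => ?_) hμ
      have h1 := hV.norm_one_sub_apply_le hT hν y
      have e : ((ν - 1 : ℝ) : 𝕜) • y = (algebraMap 𝕜 (X →L[𝕜] X) ν - V) y - (1 - V) y := by
        rw [algebraMap_sub_apply, sub_apply, one_apply_eq_self]
        push_cast
        module
      have h2 := norm_sub_le ((algebraMap 𝕜 (X →L[𝕜] X) ν - V) y) ((1 - V) y)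
      rw [← e, norm_smul, RCLike.norm_ofReal, abs_of_pos (sub_pos.2 hν)] at h2
      -- As `ν + 1 ≥ 2`, this gives `‖(1 - V) y‖ ≤ ‖(ν - V) y‖`; the triangle inequality then yields
      -- the constant `2`.
      have h3 : 2 * ‖(1 - V) y‖ ≤ (ν + 1) * ‖(1 - V) y‖ :=
        mul_le_mul_of_nonneg_right (by linarith) (norm_nonneg _)
      linarith
    refine ⟨hV.injective_sub_one, hV.denseRange_sub_one, hres, fun μ hμ => ?_⟩
    have hμ0 : 0 < μ + 1 := by linarith
    refine norm_mul_resolvent_le (hres μ hμ) (by positivity) fun y => ?_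
    rw [div_mul_eq_mul_div, le_div_iff₀ hμ0, mul_comm]
    exact hV.norm_one_sub_apply_le hT hμ y
  tfae_have 2 → 3 := fun ⟨hi, hd, hres, hbd⟩ =>
    ⟨hi, hd, 2, one_lt_two, fun μ h _ => hres μ h, fun μ h _ => hbd μ h⟩
  tfae_have 3 → 1 := by
    rintro ⟨-, hd, μ₀, hμ₀, hres, hbd⟩
    obtain ⟨μ, -, hμ, hlim⟩ := exists_seq_strictAnti_tendsto' hμ₀
    exact exists_isCogenerator_of_norm_le hd (fun n => (hμ n).1) hlim
      (fun n => hres _ (hμ n).1 (hμ n).2) fun n => hbd _ (hμ n).1 (hμ n).2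
  tfae_finish
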